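/- **Conventions.** All CAT(-1) spaces are nonempty geodesic metric spaces. A space is proper if its closed balls are compact. It has the geodesic extension property if every nonconstant geodesic segment extends to a bi-infinite geodesic line. The space of directions at $p$ is the set of nonconstant geodesics issuing from $p$, two of them being identified when their Alexandrov angle at $p$ is zero, with the Alexandrov angle as metric. An action of a (discrete) group $G$ on a metric space is geometric if it is isometric, proper, free and cocompact. For an isometric action of $G$ on $X$, the translation length of $g\in G$ is $\tau_X(g)=\inf_{x\in X}d(gx,x)$. For $C\ge 0$, a map $\phi:X\to Y$ of metric spaces is a $C$-almost-isometry if $$d_X(x_1,x_2)-C\le d_Y(\phi x_1,\phi x_2)\le d_X(x_1,x_2)+C\qquad (x_1,x_2\in X)$$ and every $y\in Y$ is within distance $C$ of $\phi(X)$. The spaces $X$ and $Y$ are almost-isometric if there is a $C$-almost-isometry $X\to Y$ for some $C\geq 0$. A map $f:X\to Y$ is coarsely onto if there is $C\ge 0$ such that every $y\in Y$ is within distance $C$ of $f(X)$. An isometric embedding is a distance-preserving map, not necessarily onto. The space $Y$ is almost-isometrically rigid if for every almost-isometry $f:Y\to Y$ there is a surjective isometry $e:Y\to Y$ with $\sup_{y\in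 Y} d(f(y),e(y))<\infty$. A geometric action of $G$ on a complete CAT(-1) space $X$ is marked length spectrum rigid if, for every complete CAT(-1) space $Z$ with a geometric $G$-action such that $\tau_X(g)=\tau_Z(g)$ for all $g\in G$, there is a $G$-equivariant isometric embedding $X\to Z$. **Theorem 1.1.** Let $G$ be a group acting geometrically on a proper CAT(-1) space $X$ that is not isometric to $\mathbb R$. Let $Y$ be a proper CAT(-1) space that has the geodesic extension property and all of whose spaces of directions are connected. Assume that $Y$ is almost-isometrically rigid and that the $G$-action on $X$ is marked length spectrum rigid. Then $X$ and $Y$ are almost-isometric if and only if there is a coarsely onto isometric embedding $X\to Y$. -/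

import Mathlib

open Filter Topology Set

/-- `c` restricted to `s` is a geodesic parametrized by arc length. -/
def IsGeodesicOn {X : Type*} [MetricSpace X] (c : ℝ → X) (s : Set ℝ) : Prop :=
  ∀ t ∈ s, ∀ t' ∈ s, dist (c t) (c t') = |t - t'|

/-- Any two points are joined by a geodesic segment. -/
def IsGeodesicMetricSpace (X : Type*) [MetricSpace X] : Prop :=
  ∀ x y : X, ∃ c : ℝ → X, c 0 = x ∧ c (dist x y) = y ∧ IsGeodesicOn c (Icc 0 (dist x y))

/-- CAT(-1) spaces: nonempty geodesic metric spaces all of whose geodesic triangles are at least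
as thin as their comparison triangles in the hyperbolic plane `UpperHalfPlane` (whose metric in
Mathlib has curvature `-1`). In a geodesic space a point `x` lies on some geodesic segment from
`p` to `q` exactly when `dist p x + dist x q = dist p q`. Here `x`, `y` are arbitrary points on two
sides `[p, q]`, `[p, r]` of a geodesic triangle, `p' q' r'` is a comparison triangle, and `x'`, `y'`
are the comparison points. -/
structure IsCATNegOne (X : Type*) [MetricSpace X] : Prop where
  nonempty : Nonempty X
  geodesic : IsGeodesicMetricSpace X
  comparison : ∀ (p q r x y : X) (p' q' r' x' y' : UpperHalfPlane),
    dist p' q' = dist p q → dist q' r' = dist q r → dist p' r' = dist p r →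
    dist p x + dist x q = dist p q → dist p' x' = dist p x → dist x' q' = dist x q →
    dist p y + dist y r = dist p r → dist p' y' = dist p y → dist y' r' = dist y r →
    dist x y ≤ dist x' y'

/-- The geodesic extension property: every nonconstant geodesic segment extends to a bi-infinite
geodesic line. -/
def HasGeodesicExtension (X : Type*) [MetricSpace X] : Prop :=
  ∀ (c : ℝ → X) (a b : ℝ), a < b → IsGeodesicOn c (Icc a b) →
    ∃ c' : ℝ → X, IsGeodesicOn c' univ ∧ EqOn c' c (Icc a b)

/-! ### Alexandrov angles and spaces of directions -/

/-- The Euclidean comparison angle at `p` (law of cosines). -/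
noncomputable def comparisonAngle {X : Type*} [MetricSpace X] (p x y : X) : ℝ :=
  Real.arccos ((dist p x ^ 2 + dist p y ^ 2 - dist x y ^ 2) / (2 * dist p x * dist p y))

/-- Nonconstant geodesics issuing from `p`. The values of `toFun` outside `[0, length]` play no
role: they do not affect the direction at `p` defined below. -/
structure GeodesicFrom {X : Type*} [MetricSpace X] (p : X) where
  toFun : ℝ → X
  length : ℝ
  length_pos : 0 < length
  map_zero : toFun 0 = p
  isGeodesicOn : IsGeodesicOn toFun (Icc 0 length)

/-- The Alexandrov (upper) angle at `p` between two geodesics issuing from `p`. -/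
noncomputable def alexandrovAngle {X : Type*} [MetricSpace X] {p : X} (c c' : GeodesicFrom p) : ℝ :=
  limsup (fun s : ℝ × ℝ => comparisonAngle p (c.toFun s.1) (c'.toFun s.2)) (𝓝[>] 0 ×ˢ 𝓝[>] 0)

section AngleLemmas

variable {X : Type*} [MetricSpace X] {p : X}

theorem comparisonAngle_nonneg (p x y : X) : 0 ≤ comparisonAngle p x y := Real.arccos_nonneg _

theorem comparisonAngle_le_pi (p x y : X) : comparisonAngle p x y ≤ Real.pi := Real.arccos_le_pi _

theorem comparisonAngle_comm (p x y : X) : comparisonAngle p x y = comparisonAngle p y x := by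
  unfold comparisonAngle
  rw [dist_comm x y]
  congr 1
  ring

theorem GeodesicFrom.dist_eq (c : GeodesicFrom p) {t : ℝ} (h0 : 0 ≤ t) (h1 : t ≤ c.length) :
    dist p (c.toFun t) = t := by
  have h := c.isGeodesicOn 0 ⟨le_refl _, c.length_pos.le⟩ t ⟨h0, h1⟩
  rw [c.map_zero] at h
  rw [h, zero_sub, abs_neg, abs_of_nonneg h0]

theorem alexandrovAngle_comm (c c' : GeodesicFrom p) :
    alexandrovAngle c c' = alexandrovAngle c' c := by
  unfold alexandrovAngle
  conv_lhs => rw [Filter.prod_comm, limsup, Filter.map_map]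
  rw [limsup]
  congr 2
  funext s
  exact comparisonAngle_comm _ _ _

theorem eventually_small {a : ℝ} (ha : 0 < a) :
    ∀ᶠ s : ℝ × ℝ in 𝓝[>] 0 ×ˢ 𝓝[>] 0, (0 < s.1 ∧ s.1 ≤ a) ∧ (0 < s.2 ∧ s.2 ≤ a) := by
  have h : ∀ᶠ t : ℝ in 𝓝[>] 0, 0 < t ∧ t ≤ a := Ioc_mem_nhdsGT ha
  exact h.prod_mk h

theorem alexandrovAngle_self (c : GeodesicFrom p) : alexandrovAngle c c = 0 := by
  unfold alexandrovAngle
  rw [limsup_congr (v := fun _ => (0 : ℝ)), limsup_const]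
  filter_upwards [eventually_small c.length_pos] with s hs
  obtain ⟨⟨h1, h2⟩, h3, h4⟩ := hs
  unfold comparisonAngle
  rw [c.dist_eq h1.le h2, c.dist_eq h3.le h4, c.isGeodesicOn _ ⟨h1.le, h2⟩ _ ⟨h3.le, h4⟩, sq_abs]
  have : (s.1 ^ 2 + s.2 ^ 2 - (s.1 - s.2) ^ 2) / (2 * s.1 * s.2) = 1 := by
    field_simp
    ring
  rw [this, Real.arccos_one]

theorem alexandrovAngle_bddAbove (c c' : GeodesicFrom p) :
    IsBoundedUnder (· ≤ ·) (𝓝[>] (0 : ℝ) ×ˢ 𝓝[>] (0 : ℝ))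
      (fun s : ℝ × ℝ => comparisonAngle p (c.toFun s.1) (c'.toFun s.2)) :=
  isBoundedUnder_of ⟨Real.pi, fun _ => comparisonAngle_le_pi _ _ _⟩

theorem alexandrovAngle_bddBelow (c c' : GeodesicFrom p) :
    IsBoundedUnder (· ≥ ·) (𝓝[>] (0 : ℝ) ×ˢ 𝓝[>] (0 : ℝ))
      (fun s : ℝ × ℝ => comparisonAngle p (c.toFun s.1) (c'.toFun s.2)) :=
  isBoundedUnder_of ⟨0, fun _ => comparisonAngle_nonneg _ _ _⟩

theorem alexandrovAngle_nonneg (c c' : GeodesicFrom p) : 0 ≤ alexandrovAngle c c' :=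
  le_limsup_of_frequently_le
    (Eventually.frequently (Eventually.of_forall fun _ => comparisonAngle_nonneg _ _ _))
    (alexandrovAngle_bddAbove c c')

/-- If the comparison angle is less than `θ ≤ π`, the opposite side is shorter than that of the
Euclidean triangle with angle `θ`. -/
theorem dist_sq_lt_of_comparisonAngle_lt {x y : X} {θ : ℝ} (hx : 0 < dist p x) (hy : 0 < dist p y)
    (hθ : θ ≤ Real.pi) (h : comparisonAngle p x y < θ) :
    dist x y ^ 2 < dist p x ^ 2 + dist p y ^ 2 - 2 * dist p x * dist p y * Real.cos θ := by
  have hc := Real.cos_lt_cos_of_nonneg_of_le_pi (comparisonAngle_nonneg p x y) hθ h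
  unfold comparisonAngle at hc
  have t1 := dist_triangle_left x y p
  have t2 := dist_triangle p x y
  have t3 := dist_triangle_right p x y
  have hd : 0 < 2 * dist p x * dist p y := by positivity
  have h2 : |dist p x - dist p y| ≤ dist x y := by
    rw [abs_le]; constructor <;> linarith
  have h3 : (dist p x - dist p y) ^ 2 ≤ dist x y ^ 2 := by
    rw [← sq_abs (dist p x - dist p y)]
    gcongr
  have h4 : dist x y ^ 2 ≤ (dist p x + dist p y) ^ 2 := by
    gcongr
  rw [Real.cos_arccos (by rw [le_div_iff₀ hd]; nlinarith) (by rw [div_le_iff₀ hd]; nlinarith),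
    lt_div_iff₀ hd] at hc
  linarith

/-- If the comparison angle exceeds `θ ≥ 0`, the opposite side is longer than that of the
Euclidean triangle with angle `θ`. -/
theorem lt_dist_sq_of_lt_comparisonAngle {x y : X} {θ : ℝ} (hx : 0 < dist p x) (hy : 0 < dist p y)
    (hθ : 0 ≤ θ) (h : θ < comparisonAngle p x y) :
    dist p x ^ 2 + dist p y ^ 2 - 2 * dist p x * dist p y * Real.cos θ < dist x y ^ 2 := by
  have hc := Real.cos_lt_cos_of_nonneg_of_le_pi hθ (comparisonAngle_le_pi p x y) h
  unfold comparisonAngle at hc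
  have t1 := dist_triangle_left x y p
  have t2 := dist_triangle p x y
  have t3 := dist_triangle_right p x y
  have hd : 0 < 2 * dist p x * dist p y := by positivity
  have h2 : |dist p x - dist p y| ≤ dist x y := by
    rw [abs_le]; constructor <;> linarith
  have h3 : (dist p x - dist p y) ^ 2 ≤ dist x y ^ 2 := by
    rw [← sq_abs (dist p x - dist p y)]
    gcongr
  have h4 : dist x y ^ 2 ≤ (dist p x + dist p y) ^ 2 := by
    gcongr
  rw [Real.cos_arccos (by rw [le_div_iff₀ hd]; nlinarith) (by rw [div_le_iff₀ hd]; nlinarith),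
    div_lt_iff₀ hd] at hc
  linarith

/-- Planar fact: in a Euclidean triangle with sides `u`, `v` enclosing the angle `α + β < π`, the
ray splitting the angle into `α` and `β` meets the opposite side at distance `t`, and cuts it into
the pieces `A`, `B` given by the law of cosines. -/
theorem exists_split {u v α β : ℝ} (hu : 0 < u) (hv : 0 < v) (hα : 0 < α) (hβ : 0 < β)
    (hαβ : α + β < Real.pi) :
    ∃ t A B : ℝ, 0 < t ∧ t ≤ max u v ∧ 0 ≤ A ∧ 0 ≤ B ∧
      A ^ 2 = u ^ 2 + t ^ 2 - 2 * u * t * Real.cos α ∧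
      B ^ 2 = t ^ 2 + v ^ 2 - 2 * t * v * Real.cos β ∧
      (A + B) ^ 2 = u ^ 2 + v ^ 2 - 2 * u * v * Real.cos (α + β) := by
  have sα : 0 < Real.sin α := Real.sin_pos_of_pos_of_lt_pi hα (by linarith)
  have sβ : 0 < Real.sin β := Real.sin_pos_of_pos_of_lt_pi hβ (by linarith)
  have sαβ : 0 < Real.sin (α + β) := Real.sin_pos_of_pos_of_lt_pi (by linarith) hαβ
  have pα := Real.sin_sq_add_cos_sq α
  have pβ := Real.sin_sq_add_cos_sq β
  have hs := Real.sin_add α β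
  have hc := Real.cos_add α β
  have ca := Real.cos_le_one α
  have cb := Real.cos_le_one β
  set sa := Real.sin α
  set sb := Real.sin β
  set a := Real.cos α
  set b := Real.cos β
  set D := u * sa + v * sb with hD
  have hDpos : 0 < D := by positivity
  set S := Real.sin (α + β) with hS
  set W := u ^ 2 + v ^ 2 - 2 * u * v * Real.cos (α + β) with hW
  have hWnn : 0 ≤ W := by
    have := Real.cos_le_one (α + β)
    nlinarith [sq_nonneg (u - v), mul_pos hu hv]
  have hsq := Real.sq_sqrt hWnn
  have hsn := Real.sqrt_nonneg W
  refine ⟨u * v * S / D, u * sa / D * Real.sqrt W, v * sb / D * Real.sqrt W, by positivity, ?_,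
    by positivity, by positivity, ?_, ?_, ?_⟩
  · rw [div_le_iff₀ hDpos, hs]
    have h1 : u ≤ max u v := le_max_left _ _
    have h2 : v ≤ max u v := le_max_right _ _
    have e1 : u * sa * (v * b) ≤ u * sa * max u v := by
      gcongr
      nlinarith
    have e2 : v * sb * (u * a) ≤ v * sb * max u v := by
      gcongr
      nlinarith
    rw [hD]
    nlinarith
  · rw [mul_pow, hsq, hW, hc, hs, div_pow]
    field_simp
    rw [hD]
    have ha : a ^ 2 = 1 - sa ^ 2 := by linarith
    have hb : b ^ 2 = 1 - sb ^ 2 := by linarith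
    grind
  · rw [mul_pow, hsq, hW, hc, hs, div_pow]
    field_simp
    rw [hD]
    have ha : a ^ 2 = 1 - sa ^ 2 := by linarith
    have hb : b ^ 2 = 1 - sb ^ 2 := by linarith
    grind
  · rw [← add_mul, ← add_div, ← hD, div_self hDpos.ne', one_mul, hsq]

theorem alexandrovAngle_triangle (c₁ c₂ c₃ : GeodesicFrom p) :
    alexandrovAngle c₁ c₃ ≤ alexandrovAngle c₁ c₂ + alexandrovAngle c₂ c₃ := by
  by_contra! hlt
  set A12 := alexandrovAngle c₁ c₂ with h12
  set A23 := alexandrovAngle c₂ c₃ with h23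
  set A13 := alexandrovAngle c₁ c₃ with h13
  have n12 : 0 ≤ A12 := alexandrovAngle_nonneg _ _
  have n23 : 0 ≤ A23 := alexandrovAngle_nonneg _ _
  have hpi : A13 ≤ Real.pi :=
    limsup_le_of_le (alexandrovAngle_bddBelow c₁ c₃).isCoboundedUnder_le
      (Eventually.of_forall fun _ => comparisonAngle_le_pi _ _ _)
  set δ := (A13 - (A12 + A23)) / 3 with hδ
  have hδ0 : 0 < δ := by rw [hδ]; linarith
  have e12 := eventually_lt_of_limsup_lt (b := A12 + δ)
    (show limsup _ _ < _ from (by linarith : A12 < A12 + δ)) (alexandrovAngle_bddAbove c₁ c₂)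
  have e23 := eventually_lt_of_limsup_lt (b := A23 + δ)
    (show limsup _ _ < _ from (by linarith : A23 < A23 + δ)) (alexandrovAngle_bddAbove c₂ c₃)
  have f13 := frequently_lt_of_lt_limsup (b := A13 - δ)
    (alexandrovAngle_bddBelow c₁ c₃).isCoboundedUnder_le
    (show _ < limsup _ _ from (by linarith : A13 - δ < A13))
  have key : ∀ {P : ℝ × ℝ → Prop}, (∀ᶠ s in 𝓝[>] (0 : ℝ) ×ˢ 𝓝[>] (0 : ℝ), P s) →
      ∃ ε > 0, ∀ s t : ℝ, 0 < s → s ≤ ε → 0 < t → t ≤ ε → P (s, t) := by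
    intro P hP
    have hb := (nhdsGT_basis_Ioc (0 : ℝ)).prod_self
    obtain ⟨ε, hε, h⟩ := hb.mem_iff.1 hP
    exact ⟨ε, hε, fun s t h1 h2 h3 h4 => h ⟨⟨h1, h2⟩, h3, h4⟩⟩
  obtain ⟨ε₁, hε₁, g12⟩ := key e12
  obtain ⟨ε₂, hε₂, g23⟩ := key e23
  obtain ⟨ε, hε, l1, l2, l3, l4, l5⟩ : ∃ ε > 0, ε ≤ ε₁ ∧ ε ≤ ε₂ ∧ ε ≤ c₁.length ∧ ε ≤ c₂.length ∧
      ε ≤ c₃.length :=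
    ⟨min ε₁ (min ε₂ (min c₁.length (min c₂.length c₃.length))), by
      simp [hε₁, hε₂, c₁.length_pos, c₂.length_pos, c₃.length_pos], by simp, by simp, by simp,
      by simp, by simp⟩
  obtain ⟨⟨u, v⟩, hang, ⟨hu, huε⟩, hv, hvε⟩ := (f13.and_eventually (eventually_small hε)).exists
  simp only at hang hu huε hv hvε
  obtain ⟨t, A, B, ht, htm, hA, hB, eA, eB, eAB⟩ := exists_split (α := A12 + δ) (β := A23 + δ)
    hu hv (by linarith) (by linarith) (by rw [hδ]; linarith)
  have htε : t ≤ ε := htm.trans (max_le huε hvε)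
  have d1 : dist p (c₁.toFun u) = u := c₁.dist_eq hu.le (by linarith)
  have d2 : dist p (c₂.toFun t) = t := c₂.dist_eq ht.le (by linarith)
  have d3 : dist p (c₃.toFun v) = v := c₃.dist_eq hv.le (by linarith)
  have r1 := dist_sq_lt_of_comparisonAngle_lt (by rwa [d1]) (by rwa [d2])
    (by linarith) (g12 u t hu (by linarith) ht (by linarith))
  have r2 := dist_sq_lt_of_comparisonAngle_lt (by rwa [d2]) (by rwa [d3])
    (by linarith) (g23 t v ht (by linarith) hv (by linarith))
  have r3 := lt_dist_sq_of_lt_comparisonAngle (θ := A12 + δ + (A23 + δ)) (by rwa [d1])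
    (by rwa [d3]) (by linarith) (lt_of_le_of_lt (by rw [hδ]; linarith) hang)
  simp only [d1, d2, d3] at r1 r2 r3
  rw [← eA] at r1
  rw [← eB] at r2
  rw [← eAB] at r3
  have q1 := lt_of_pow_lt_pow_left₀ 2 hA r1
  have q2 := lt_of_pow_lt_pow_left₀ 2 hB r2
  have q3 := lt_of_pow_lt_pow_left₀ 2 dist_nonneg r3
  linarith [dist_triangle (c₁.toFun u) (c₂.toFun t) (c₃.toFun v)]

end AngleLemmas

/-- The Alexandrov angle as a pseudometric on nonconstant geodesics issuing from `p`. -/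
noncomputable instance GeodesicFrom.instPseudoMetricSpace {X : Type*} [MetricSpace X] (p : X) :
    PseudoMetricSpace (GeodesicFrom p) where
  dist := alexandrovAngle
  dist_self := alexandrovAngle_self
  dist_comm := alexandrovAngle_comm
  dist_triangle := alexandrovAngle_triangle

/-- The space of directions at `p`: nonconstant geodesics issuing from `p`, identified when they
make angle zero, with the Alexandrov angle as metric. -/
abbrev SpaceOfDirections {X : Type*} [MetricSpace X] (p : X) : Type _ :=
  SeparationQuotient (GeodesicFrom p)

/-- All spaces of directions are connected. (The empty space of directions, which in the presence
of geodesic extension occurs only for the one-point space, is allowed.) -/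
def HasConnectedDirections (X : Type*) [MetricSpace X] : Prop :=
  ∀ p : X, PreconnectedSpace (SpaceOfDirections p)

/-! ### Almost-isometries -/

/-- `f` is coarsely onto. -/
def IsCoarselyOnto {X Y : Type*} [MetricSpace Y] (f : X → Y) : Prop :=
  ∃ C : ℝ, 0 ≤ C ∧ ∀ y : Y, ∃ x : X, dist (f x) y ≤ C

/-- `f` is a `C`-almost-isometry, i.e. a `(1, C)`-quasi-isometry. -/
structure IsAlmostIsometryWith {X Y : Type*} [MetricSpace X] [MetricSpace Y] (C : ℝ)
    (f : X → Y) : Prop where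
  nonneg : 0 ≤ C
  lower : ∀ x₁ x₂ : X, dist x₁ x₂ - C ≤ dist (f x₁) (f x₂)
  upper : ∀ x₁ x₂ : X, dist (f x₁) (f x₂) ≤ dist x₁ x₂ + C
  coarselyOnto : ∀ y : Y, ∃ x : X, dist (f x) y ≤ C

/-- `X` and `Y` are almost-isometric. -/
def AlmostIsometric (X Y : Type*) [MetricSpace X] [MetricSpace Y] : Prop :=
  ∃ (C : ℝ) (f : X → Y), IsAlmostIsometryWith C f

/-- Every self almost-isometry is at bounded distance from an isometry. -/
def IsAIRigid (Y : Type*) [MetricSpace Y] : Prop :=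
  ∀ (C : ℝ) (f : Y → Y), IsAlmostIsometryWith C f →
    ∃ (e : Y ≃ᵢ Y) (L : ℝ), ∀ y : Y, dist (f y) (e y) ≤ L

/-! ### Geometric actions and marked length spectrum rigidity -/

/-- The action of the (discrete) group `G` on `X` is isometric, proper, free and cocompact. -/
structure IsGeometricAction (G X : Type*) [Group G] [MetricSpace X] [MulAction G X] : Prop where
  isometric : ∀ g : G, Isometry (fun x : X => g • x)
  proper : ∀ K : Set X, IsCompact K → {g : G | ((fun x => g • x) '' K ∩ K).Nonempty}.Finite
  free : ∀ (g : G) (x : X), g • x = x → g = 1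
  cocompact : ∃ K : Set X, IsCompact K ∧ ∀ x : X, ∃ g : G, ∃ k ∈ K, g • k = x

/-- The translation length of `g` acting on `X`. -/
noncomputable def translationLength {G : Type*} (X : Type*) [Group G] [MetricSpace X]
    [MulAction G X] (g : G) : ℝ :=
  ⨅ x : X, dist (g • x) x

universe u v w

/-- Marked length spectrum rigidity of the `G`-action on `X`: `X` embeds isometrically and
equivariantly in every complete CAT(-1) space (in the universe `v`) with a geometric `G`-action
having the same translation lengths. -/
def IsMLSRigid (G : Type w) (X : Type u) [Group G] [MetricSpace X] [MulAction G X] : Prop :=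
  ∀ (Z : Type v) [MetricSpace Z] [CompleteSpace Z] [MulAction G Z],
    IsCATNegOne Z → IsGeometricAction G Z →
    (∀ g : G, translationLength X g = translationLength Z g) →
    ∃ f : X → Z, Isometry f ∧ ∀ (g : G) (x : X), f (g • x) = g • f x

/-! A coarsely onto isometric embedding is an almost-isometry. Conversely, let `φ : X → Y` be an
almost-isometry with coarse inverse `ψ`. Each map `y ↦ φ (g • ψ y)` is an almost-isometry of `Y`,
with constants independent of `g`, so rigidity of `Y` puts an isometry `e g` at finite distance from
it. Two facts turn the `e g` into an action coarsely conjugate to that on `X`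
(`exists_coarsely_conjugate_action`).

First, an isometry at finite distance from the identity is the identity (`isometry_eq_id`), so `e`
is multiplicative. If `p` were moved to `e p ≠ p`, connectedness of directions would give a line
through `p` perpendicular to `[p, e p]`. Its image is asymptotic to it, hence has the same image
set, so `e p` lies on the line and the angle is `0` or `π`, a contradiction.

Second, a coarse isometry at finite distance from the identity is within a bound depending only on
its additive constant (`dist_le_of_coarse_isometry`). A point `p` is the coarse centre of three rays
pairwise at angle at least `π / 2`; the map almost fixes their ends, hence coarsely fixes the
centre. This makes the distance from `e g` to the conjugated map uniform in `g`.

The action on `Y` is geometric; freeness holds because a fixed point in `Y` bounds an orbit in `X`,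
whose circumcentre is then fixed. Displacements in `X` and `Y` differ by a bounded amount, and
passing to powers `g ^ 2 ^ k` removes the error, so the translation lengths agree. Marked length
spectrum rigidity gives an equivariant isometric embedding, which is coarsely onto by cocompactness.
-/

/-! ### Hyperbolic polar coordinates -/

/-- The point of the upper half-plane at distance `s` from `I`, in the direction making with the
upward vertical the angle of cosine `u` and sine `w`. -/
noncomputable def hyperbolicPolar (s u w : ℝ) (h : u ^ 2 + w ^ 2 = 1) : UpperHalfPlane where
  coe := ⟨Real.sinh s * w / (Real.cosh s - Real.sinh s * u), 1 / (Real.cosh s - Real.sinh s * u)⟩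
  coe_im_pos := by
    have h1 := Real.cosh_sq s
    have h2 := Real.cosh_pos s
    have : Real.sinh s * u < Real.cosh s := by
      apply lt_of_pow_lt_pow_left₀ 2 h2.le
      nlinarith [mul_nonneg (sq_nonneg (Real.sinh s)) (sq_nonneg w)]
    have : 0 < Real.cosh s - Real.sinh s * u := by linarith
    simpa using this

/-- The hyperbolic law of cosines at the origin: `u * u' + w * w'` is the cosine of the angle
between the two directions. -/
theorem cosh_dist_hyperbolicPolar (s t u w u' w' : ℝ) (h : u ^ 2 + w ^ 2 = 1)
    (h' : u' ^ 2 + w' ^ 2 = 1) :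
    Real.cosh (dist (hyperbolicPolar s u w h) (hyperbolicPolar t u' w' h')) =
      Real.cosh s * Real.cosh t - Real.sinh s * Real.sinh t * (u * u' + w * w') := by
  have hp := (hyperbolicPolar s u w h).coe_im_pos
  have hp' := (hyperbolicPolar t u' w' h').coe_im_pos
  rw [UpperHalfPlane.cosh_dist, Complex.dist_eq, Complex.sq_norm, Complex.normSq_sub,
    Complex.normSq_apply, Complex.normSq_apply]
  simp only [UpperHalfPlane.im, hyperbolicPolar, Complex.mul_re, Complex.conj_re,
    Complex.conj_im] at hp hp' ⊢
  simp only [one_div, inv_pos] at hp hp'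
  have e1 := Real.cosh_sq s
  have e2 := Real.cosh_sq t
  field_simp
  generalize Real.cosh s = C at *
  generalize Real.cosh t = D at *
  generalize Real.sinh s = S at *
  generalize Real.sinh t = T at *
  grind

theorem Real.eq_of_cosh_eq {x y : ℝ} (hx : 0 ≤ x) (hy : 0 ≤ y) (h : Real.cosh x = Real.cosh y) :
    x = y := by
  have h1 := Real.cosh_le_cosh.1 h.le
  have h2 := Real.cosh_le_cosh.1 h.ge
  rw [abs_of_nonneg hx, abs_of_nonneg hy] at h1 h2
  exact le_antisymm h1 h2

theorem Real.cosh_le_cosh_of_le {x y : ℝ} (hx : 0 ≤ x) (h : x ≤ y) :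
    Real.cosh x ≤ Real.cosh y :=
  Real.cosh_le_cosh.2 (by rwa [abs_of_nonneg hx, abs_of_nonneg (hx.trans h)])

theorem Real.cosh_eq_one_add_sinh_half_sq (x : ℝ) :
    Real.cosh x = 1 + 2 * Real.sinh (x / 2) ^ 2 := by
  have h := Real.cosh_two_mul (x / 2)
  rw [Real.cosh_sq] at h
  rw [mul_div_cancel₀ x two_ne_zero] at h
  linarith

theorem dist_hyperbolicPolar_same (s t u w : ℝ) (h : u ^ 2 + w ^ 2 = 1) :
    dist (hyperbolicPolar s u w h) (hyperbolicPolar t u w h) = |s - t| := by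
  apply Real.eq_of_cosh_eq dist_nonneg (abs_nonneg _)
  rw [cosh_dist_hyperbolicPolar, Real.cosh_abs, Real.cosh_sub]
  have : u * u + w * w = 1 := by linarith
  rw [this, mul_one]

/-- Solving the law of cosines for `k`, the triangle inequalities `cosh (a - b) ≤ cosh c ≤ cosh (a +
b)` say exactly that `|k| ≤ 1`. If a side at the vertex vanishes, any `k` will do. -/
theorem exists_hyperbolic_cosine {a b c : ℝ} (ha : 0 ≤ a) (hb : 0 ≤ b) (h1 : |a - b| ≤ c)
    (h2 : c ≤ a + b) :
    ∃ k : ℝ, -1 ≤ k ∧ k ≤ 1 ∧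
      Real.cosh c = Real.cosh a * Real.cosh b - Real.sinh a * Real.sinh b * k := by
  have hc : 0 ≤ c := (abs_nonneg _).trans h1
  have e1 : Real.cosh (a - b) ≤ Real.cosh c := Real.cosh_le_cosh.2 (by rwa [abs_of_nonneg hc])
  have e2 : Real.cosh c ≤ Real.cosh (a + b) := Real.cosh_le_cosh_of_le hc h2
  rw [Real.cosh_sub] at e1
  rw [Real.cosh_add] at e2
  have hP : 0 ≤ Real.sinh a * Real.sinh b :=
    mul_nonneg (Real.sinh_nonneg_iff.2 ha) (Real.sinh_nonneg_iff.2 hb)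
  rcases hP.eq_or_lt with hP | hP
  · refine ⟨0, by norm_num, by norm_num, ?_⟩
    rw [← hP] at e1 e2 ⊢
    linarith
  · refine ⟨(Real.cosh a * Real.cosh b - Real.cosh c) / (Real.sinh a * Real.sinh b), ?_, ?_, ?_⟩
    · rw [le_div_iff₀ hP]; linarith
    · rw [div_le_iff₀ hP]; linarith
    · rw [mul_div_cancel₀ _ hP.ne']; ring

/-! ### Comparison inequalities: thin triangles, the four-point condition, medians -/

namespace IsCATNegOne

variable {X : Type*} [MetricSpace X]

/-- The CAT(-1) inequality in polar coordinates at the vertex `p`; `k` is the cosine of the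
comparison angle at `p`. -/
theorem polar (hX : IsCATNegOne X) {p q r x y : X} (hx : dist p x + dist x q = dist p q)
    (hy : dist p y + dist y r = dist p r) :
    ∃ k : ℝ, -1 ≤ k ∧ k ≤ 1 ∧
      Real.cosh (dist q r) = Real.cosh (dist p q) * Real.cosh (dist p r) -
        Real.sinh (dist p q) * Real.sinh (dist p r) * k ∧
      Real.cosh (dist x y) ≤ Real.cosh (dist p x) * Real.cosh (dist p y) -
        Real.sinh (dist p x) * Real.sinh (dist p y) * k := by
  have t1 := dist_triangle p q r
  have t2 := dist_triangle_right p q r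
  have t3 := dist_triangle_left q r p
  obtain ⟨k, hk1, hk2, hk⟩ := exists_hyperbolic_cosine (c := dist q r)
    (dist_nonneg (x := p) (y := q))
    (dist_nonneg (x := p) (y := r)) (by
      rw [abs_le]; constructor <;> linarith) t3
  refine ⟨k, hk1, hk2, hk, ?_⟩
  have hw : k ^ 2 + √(1 - k ^ 2) ^ 2 = 1 := by
    rw [Real.sq_sqrt (by nlinarith)]; ring
  have h0 : (1 : ℝ) ^ 2 + 0 ^ 2 = 1 := by norm_num
  have key : ∀ s t : ℝ, Real.cosh (dist (hyperbolicPolar s 1 0 h0) (hyperbolicPolar t k _ hw)) =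
      Real.cosh s * Real.cosh t - Real.sinh s * Real.sinh t * k := by
    intro s t
    rw [cosh_dist_hyperbolicPolar]; ring
  have base : hyperbolicPolar 0 1 0 h0 = hyperbolicPolar 0 k _ hw := by
    apply dist_eq_zero.1
    apply Real.eq_of_cosh_eq dist_nonneg le_rfl
    rw [key]; simp
  have hcmp := hX.comparison p q r x y (hyperbolicPolar 0 1 0 h0)
    (hyperbolicPolar (dist p q) 1 0 h0)
    (hyperbolicPolar (dist p r) k _ hw) (hyperbolicPolar (dist p x) 1 0 h0)
    (hyperbolicPolar (dist p y) k _ hw)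
    (by rw [dist_hyperbolicPolar_same, zero_sub, abs_neg, abs_of_nonneg dist_nonneg])
    (Real.eq_of_cosh_eq dist_nonneg dist_nonneg (by rw [key, hk]))
    (by rw [base, dist_hyperbolicPolar_same, zero_sub, abs_neg, abs_of_nonneg dist_nonneg])
    hx (by rw [dist_hyperbolicPolar_same, zero_sub, abs_neg, abs_of_nonneg dist_nonneg])
    (by rw [dist_hyperbolicPolar_same, ← hx, sub_add_cancel_left, abs_neg,
      abs_of_nonneg dist_nonneg])
    hy (by rw [base, dist_hyperbolicPolar_same, zero_sub, abs_neg, abs_of_nonneg dist_nonneg])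
    (by rw [dist_hyperbolicPolar_same, ← hy, sub_add_cancel_left, abs_neg,
      abs_of_nonneg dist_nonneg])
  rw [← key]
  exact Real.cosh_le_cosh_of_le dist_nonneg hcmp

theorem exists_between (hX : IsCATNegOne X) (p q : X) {s : ℝ} (h0 : 0 ≤ s) (h1 : s ≤ dist p q) :
    ∃ x, dist p x = s ∧ dist x q = dist p q - s := by
  obtain ⟨c, c0, c1, hc⟩ := hX.geodesic p q
  refine ⟨c s, ?_, ?_⟩
  · have := hc 0 ⟨le_rfl, dist_nonneg⟩ s ⟨h0, h1⟩
    rwa [c0, zero_sub, abs_neg, abs_of_nonneg h0] at this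
  · have := hc s ⟨h0, h1⟩ (dist p q) ⟨dist_nonneg, le_rfl⟩
    rwa [c1, abs_sub_comm, abs_of_nonneg (by linarith)] at this

/-- Points at distance `s` from the apex of an isosceles triangle with sides of length `R`. -/
theorem sinh_half_dist_mul_le (hX : IsCATNegOne X) {p q r x y : X} {R s : ℝ} (hs : 0 ≤ s)
    (hsR : s ≤ R) (hq : dist p q = R) (hr : dist p r = R) (hx : dist p x = s)
    (hxq : dist x q = R - s) (hy : dist p y = s) (hyr : dist y r = R - s) :
    Real.sinh (dist x y / 2) * Real.sinh R ≤ Real.sinh s * Real.sinh (dist q r / 2) := by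
  obtain ⟨k, -, -, h1, h2⟩ := hX.polar (p := p) (q := q) (r := r) (x := x) (y := y)
    (by linarith) (by linarith)
  rw [hq, hr, Real.cosh_eq_one_add_sinh_half_sq (dist q r)] at h1
  rw [hx, hy, Real.cosh_eq_one_add_sinh_half_sq (dist x y)] at h2
  have e1 := Real.cosh_sq s
  have e2 := Real.cosh_sq R
  have nR : 0 ≤ Real.sinh R := Real.sinh_nonneg_iff.2 (hs.trans hsR)
  have ns : 0 ≤ Real.sinh s := Real.sinh_nonneg_iff.2 hs
  have nB : 0 ≤ Real.sinh (dist q r / 2) := Real.sinh_nonneg_iff.2 (by positivity)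
  apply le_of_sq_le_sq _ (by positivity)
  -- Half-angle form of the law of cosines, with `1 - k = 2 sin² (θ / 2)`; eliminating `k` compares
  -- the two radii.
  have f1 : 2 * Real.sinh (dist q r / 2) ^ 2 = Real.sinh R ^ 2 * (1 - k) := by linarith
  have f2 : 2 * Real.sinh (dist x y / 2) ^ 2 ≤ Real.sinh s ^ 2 * (1 - k) := by linarith
  have f3 := mul_le_mul_of_nonneg_right f2 (sq_nonneg (Real.sinh R))
  have f4 : Real.sinh s ^ 2 * (2 * Real.sinh (dist q r / 2) ^ 2) =
    Real.sinh s ^ 2 * (Real.sinh R ^ 2 * (1 - k)) := by rw [f1]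
  rw [mul_pow, mul_pow]
  linarith

/-- Geodesic segments are determined by their endpoints. -/
theorem eq_of_between (hX : IsCATNegOne X) {p q x y : X} {s : ℝ} (hx : dist p x = s)
    (hxq : dist x q = dist p q - s) (hy : dist p y = s) (hyq : dist y q = dist p q - s) :
    x = y := by
  have hs : 0 ≤ s := hx ▸ dist_nonneg
  have hs' : 0 ≤ dist p q - s := hxq ▸ dist_nonneg
  have h := hX.sinh_half_dist_mul_le hs (sub_nonneg.1 hs') rfl rfl hx hxq hy hyq
  rw [dist_self, zero_div, Real.sinh_zero, mul_zero] at h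
  rcases (hs.trans (sub_nonneg.1 hs')).eq_or_lt with h0 | h0
  · have : s = 0 := by linarith
    rw [this] at hx hy
    rw [← dist_eq_zero.1 hx, ← dist_eq_zero.1 hy]
  · have := nonpos_of_mul_nonpos_left h (Real.sinh_pos_iff.2 h0)
    have := Real.sinh_nonpos_iff.1 this
    exact dist_le_zero.1 (by linarith)

/-- Triangles are thinner than tripods, up to `1`. -/
theorem dist_le_one_of_le_gromovProduct (hX : IsCATNegOne X) {p q r x y : X} {m : ℝ} (hm : 0 ≤ m)
    (hg : 2 * m ≤ dist p q + dist p r - dist q r) (hx : dist p x = m)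
    (hxq : dist x q = dist p q - m) (hy : dist p y = m) (hyr : dist y r = dist p r - m) :
    dist x y ≤ 1 := by
  obtain ⟨k, hk1, hk2, h1, h2⟩ := hX.polar (p := p) (q := q) (r := r) (x := x) (y := y)
    (by linarith) (by linarith)
  rw [hx, hy, Real.cosh_eq_one_add_sinh_half_sq (dist x y)] at h2
  have ha : 0 ≤ dist p q - m := hxq ▸ dist_nonneg
  have hb : 0 ≤ dist p r - m := hyr ▸ dist_nonneg
  set a := dist p q - m with ha'
  set b := dist p r - m with hb'
  rw [show dist p q = a + m by rw [ha']; ring, show dist p r = b + m by rw [hb']; ring] at h1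
  have h3 : Real.cosh (dist q r) ≤ Real.cosh (a + b) :=
    Real.cosh_le_cosh_of_le dist_nonneg (by linarith)
  have h4 := Real.cosh_sub (a + m) (b + m)
  rw [show a + m - (b + m) = a - b by ring, Real.cosh_sub] at h4
  rw [Real.cosh_add] at h3
  have e1 := Real.cosh_sq m
  have na : 0 ≤ Real.sinh a := Real.sinh_nonneg_iff.2 ha
  have nb : 0 ≤ Real.sinh b := Real.sinh_nonneg_iff.2 hb
  have nm : 0 ≤ Real.sinh m := Real.sinh_nonneg_iff.2 hm
  -- The left side is `cosh (dist q r) - cosh (a - b)`, the right side is `cosh (a + b) - cosh (a -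
  -- b)`.
  have h5 : Real.sinh (a + m) * Real.sinh (b + m) * (1 - k) ≤ 2 * (Real.sinh a * Real.sinh b) := by
    linarith
  have sup : ∀ c, 0 ≤ c → 2 * (Real.sinh m * Real.sinh c) ≤ Real.sinh (c + m) := by
    intro c hc
    have nc : 0 ≤ Real.sinh c := Real.sinh_nonneg_iff.2 hc
    rw [Real.sinh_add]
    have := (Real.sinh_lt_cosh c).le
    have := (Real.sinh_lt_cosh m).le
    nlinarith
  have h6 : 2 * Real.sinh (dist x y / 2) ^ 2 ≤ Real.sinh m ^ 2 * (1 - k) := by linarith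
  have h7 : 4 * Real.sinh (dist x y / 2) ^ 2 ≤ 1 := by
    rcases hm.eq_or_lt with hm0 | hm0
    · rw [← hm0, Real.sinh_zero] at h6
      linarith
    · have pP : 0 < Real.sinh (a + m) * Real.sinh (b + m) :=
        mul_pos (Real.sinh_pos_iff.2 (by linarith)) (Real.sinh_pos_iff.2 (by linarith))
      have h8 := mul_le_mul (sup a ha) (sup b hb) (by positivity)
        (Real.sinh_nonneg_iff.2 (by linarith))
      have h9 := mul_le_mul_of_nonneg_left h5 (sq_nonneg (Real.sinh m))
      have h10 := mul_le_mul_of_nonneg_right h6 pP.le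
      have : (Real.sinh (a + m) * Real.sinh (b + m)) * (4 * Real.sinh (dist x y / 2) ^ 2) ≤
          (Real.sinh (a + m) * Real.sinh (b + m)) * 1 := by nlinarith
      exact le_of_mul_le_mul_left this pP
  have h11 : dist x y / 2 ≤ Real.sinh (dist x y / 2) :=
    Real.self_le_sinh_iff.2 (by positivity)
  nlinarith [dist_nonneg (x := x) (y := y)]

/-- Gromov's four-point inequality, with doubled Gromov products. -/
theorem four_point (hX : IsCATNegOne X) (p a b c : X) :
    min (dist p a + dist p b - dist a b) (dist p b + dist p c - dist b c) - 2 ≤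
      dist p a + dist p c - dist a c := by
  set m := min (dist p a + dist p b - dist a b) (dist p b + dist p c - dist b c) / 2 with hm
  have h1 : 2 * m ≤ dist p a + dist p b - dist a b := by
    rw [hm]
    linarith [min_le_left (dist p a + dist p b - dist a b) (dist p b + dist p c - dist b c)]
  have h2 : 2 * m ≤ dist p b + dist p c - dist b c := by
    rw [hm]
    linarith [min_le_right (dist p a + dist p b - dist a b) (dist p b + dist p c - dist b c)]
  have h0 : 0 ≤ m := by
    rw [hm]
    have := dist_triangle_left a b p
    have := dist_triangle_left b c p
    have : 0 ≤ min (dist p a + dist p b - dist a b) (dist p b + dist p c - dist b c) :=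
      le_min (by linarith) (by linarith)
    linarith
  -- The points at distance `m` from `p` on the three sides are successively within `1`; the path
  -- from `a` to `c` through `x` and `z` gives the bound.
  obtain ⟨x, hx, hx'⟩ := hX.exists_between p a h0
    (by linarith [dist_triangle p b a, dist_triangle p a b, dist_comm a b])
  obtain ⟨y, hy, hy'⟩ := hX.exists_between p b h0 (by linarith [dist_triangle p b a, dist_comm a b])
  obtain ⟨z, hz, hz'⟩ := hX.exists_between p c h0 (by linarith [dist_triangle p c b, dist_comm c b])
  have d1 := hX.dist_le_one_of_le_gromovProduct h0 h1 hx hx' hy hy'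
  have d2 := hX.dist_le_one_of_le_gromovProduct h0 h2 hy hy' hz hz'
  have := dist_triangle4 a x z c
  have := dist_triangle x y z
  rw [dist_comm a x] at *
  linarith

/-- The distance of the midpoints of two sides is at most half the third side. -/
theorem dist_midpoints_le (hX : IsCATNegOne X) {p q r x y : X} {s : ℝ} (hq : dist p q = 2 * s)
    (hr : dist p r = 2 * s) (hx : dist p x = s) (hxq : dist x q = s) (hy : dist p y = s)
    (hyr : dist y r = s) : 2 * dist x y ≤ dist q r := by
  have hs : 0 ≤ s := hx ▸ dist_nonneg
  rcases hs.eq_or_lt with h0 | h0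
  · rw [← h0] at hx hy
    rw [← dist_eq_zero.1 hx, ← dist_eq_zero.1 hy, dist_self, mul_zero]
    exact dist_nonneg
  have h := hX.sinh_half_dist_mul_le hs (by linarith) hq hr hx (by linarith) hy (by linarith)
  rw [Real.sinh_two_mul] at h
  have ps := Real.sinh_pos_iff.2 h0
  have h1 : Real.sinh (dist x y / 2) * (2 * Real.cosh s) ≤ Real.sinh (dist q r / 2) := by
    apply le_of_mul_le_mul_left _ ps
    linarith
  have h2 := Real.sinh_two_mul (dist q r / 4)
  rw [show 2 * (dist q r / 4) = dist q r / 2 by ring] at h2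
  -- Here `dist q r ≤ 4 * s`; the duplication formula for `sinh (dist q r / 2)` then lets `cosh s`
  -- cancel.
  have h3 : Real.cosh (dist q r / 4) ≤ Real.cosh s :=
    Real.cosh_le_cosh_of_le (by positivity) (by linarith [dist_triangle_left q r p])
  have n4 : 0 ≤ Real.sinh (dist q r / 4) := Real.sinh_nonneg_iff.2 (by positivity)
  have h4 : Real.sinh (dist x y / 2) ≤ Real.sinh (dist q r / 4) := by
    have pc := Real.cosh_pos s
    apply le_of_mul_le_mul_right _ (by positivity : 0 < 2 * Real.cosh s)
    nlinarith
  have := Real.sinh_le_sinh.1 h4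
  linarith

/-- The median inequality. -/
theorem cosh_dist_midpoint_le (hX : IsCATNegOne X) {p q r m : X} {s : ℝ} (hq : dist q m = s)
    (hr : dist m r = s) (hqr : dist q r = 2 * s) :
    2 * Real.cosh s * Real.cosh (dist m p) ≤ Real.cosh (dist q p) + Real.cosh (dist r p) := by
  -- Comparison at the vertex `q`, with the second point at the far end of its side.
  obtain ⟨k, -, -, h1, h2⟩ := hX.polar (p := q) (q := r) (r := p) (x := m) (y := p)
    (by linarith) (by simp)
  rw [hqr, Real.cosh_two_mul, Real.sinh_two_mul] at h1
  rw [hq] at h2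
  have h3 := mul_le_mul_of_nonneg_left h2 (Real.cosh_pos s).le
  have h4 := Real.cosh_sq s
  have : Real.sinh s ^ 2 * Real.cosh (dist q p) = (Real.cosh s ^ 2 - 1) * Real.cosh (dist q p) := by
    rw [h4]; ring
  nlinarith

end IsCATNegOne

/-! ### Opposite and perpendicular directions -/

section Geodesics

variable {X : Type*} [MetricSpace X]

theorem IsGeodesicOn.isometry {c : ℝ → X} (hc : IsGeodesicOn c univ) : Isometry c :=
  Isometry.of_dist_eq fun t t' => by rw [hc t trivial t' trivial, Real.dist_eq]

theorem alexandrovAngle_eq_pi {p : X} (γ w : GeodesicFrom p) {a : ℝ} (ha : 0 < a)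
    (h : ∀ s t, 0 < s → s ≤ a → 0 < t → t ≤ a → dist (γ.toFun s) (w.toFun t) = s + t) :
    alexandrovAngle γ w = Real.pi := by
  unfold alexandrovAngle
  rw [limsup_congr (v := fun _ => Real.pi), limsup_const]
  filter_upwards [eventually_small ha, eventually_small γ.length_pos,
    eventually_small w.length_pos] with s hs hs1 hs2
  obtain ⟨⟨h1, h2⟩, h3, h4⟩ := hs
  unfold comparisonAngle
  rw [γ.dist_eq h1.le hs1.1.2, w.dist_eq h3.le hs2.2.2, h _ _ h1 h2 h3 h4]
  have : (s.1 ^ 2 + s.2 ^ 2 - (s.1 + s.2) ^ 2) / (2 * s.1 * s.2) = -1 := by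
    field_simp
    ring
  rw [this, Real.arccos_neg_one]

theorem alexandrovAngle_eq_zero {p : X} (γ w : GeodesicFrom p) {a : ℝ} (ha : 0 < a)
    (h : ∀ s, 0 < s → s ≤ a → γ.toFun s = w.toFun s) : alexandrovAngle γ w = 0 := by
  rw [← alexandrovAngle_self γ]
  unfold alexandrovAngle
  apply limsup_congr
  filter_upwards [eventually_small ha] with s hs
  rw [h _ hs.2.1 hs.2.2]

theorem exists_line (hext : HasGeodesicExtension X) {p : X} (γ : GeodesicFrom p) :
    ∃ c : ℝ → X, IsGeodesicOn c univ ∧ c 0 = p ∧ EqOn c γ.toFun (Icc 0 γ.length) := by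
  obtain ⟨c, hc, h⟩ := hext γ.toFun 0 γ.length γ.length_pos γ.isGeodesicOn
  exact ⟨c, hc, by rw [h ⟨le_rfl, γ.length_pos.le⟩, γ.map_zero], h⟩

/-- Extend `γ` to a line and run it backwards from `p`. -/
theorem exists_opposite (hext : HasGeodesicExtension X) {p : X} (γ : GeodesicFrom p) :
    ∃ w : GeodesicFrom p, alexandrovAngle γ w = Real.pi := by
  obtain ⟨c, hc, rfl, h⟩ := exists_line hext γ
  refine ⟨⟨fun t => c (-t), 1, one_pos, by simp, fun t _ t' _ => ?_⟩,
    alexandrovAngle_eq_pi _ _ γ.length_pos fun s t h1 h2 h3 _ => ?_⟩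
  · rw [hc _ trivial _ trivial, neg_sub_neg, abs_sub_comm]
  · rw [← h ⟨h1.le, h2⟩, hc _ trivial _ trivial, sub_neg_eq_add, abs_of_pos (by linarith)]

/-- The angle with `γ` is continuous on the connected space of directions, is `0` at `γ` and `π` at
an opposite direction, so it takes the value `π / 2`. -/
theorem exists_perpendicular (hext : HasGeodesicExtension X) (hdir : HasConnectedDirections X)
    {p : X} (γ : GeodesicFrom p) : ∃ w : GeodesicFrom p, alexandrovAngle γ w = Real.pi / 2 := by
  obtain ⟨o, ho⟩ := exists_opposite hext γ
  have := hdir p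
  have hcont : Continuous fun d : SpaceOfDirections p => dist (SeparationQuotient.mk γ) d := by
    fun_prop
  have hmem : Real.pi / 2 ∈ Icc (dist (SeparationQuotient.mk γ) (SeparationQuotient.mk γ))
      (dist (SeparationQuotient.mk γ) (SeparationQuotient.mk o)) := by
    rw [SeparationQuotient.dist_mk, SeparationQuotient.dist_mk]
    change _ ∈ Icc (alexandrovAngle γ γ) (alexandrovAngle γ o)
    rw [alexandrovAngle_self, ho]
    have := Real.pi_pos
    constructor <;> linarith
  obtain ⟨d, hd⟩ := intermediate_value_univ _ _ hcont hmem
  obtain ⟨w, rfl⟩ := SeparationQuotient.surjective_mk d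
  exact ⟨w, hd⟩

theorem Real.sinh_le_five_fourths {s : ℝ} (h0 : 0 ≤ s) (h1 : s ≤ 1 / 4) :
    Real.sinh s ≤ 5 / 4 * s := by
  have e1 := (abs_le.1 (Real.abs_exp_sub_one_sub_id_le (x := s)
    (abs_le.2 ⟨by linarith, by linarith⟩))).2
  have e2 := (abs_le.1 (Real.abs_exp_sub_one_sub_id_le (x := -s)
    (abs_le.2 ⟨by linarith, by linarith⟩))).1
  rw [Real.sinh_eq]
  nlinarith

end Geodesics

/-! ### Diverging rays, asymptotic lines, maps at finite distance from the identity -/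

namespace IsCATNegOne

variable {X : Type*} [MetricSpace X]

theorem exists_geodesicFrom (hX : IsCATNegOne X) {p q : X} (h : p ≠ q) :
    ∃ γ : GeodesicFrom p, γ.length = dist p q ∧ γ.toFun (dist p q) = q := by
  obtain ⟨c, c0, c1, hc⟩ := hX.geodesic p q
  exact ⟨⟨c, dist p q, dist_pos.2 h, c0, hc⟩, rfl, c1⟩

/-- Rays making an angle of at least `π / 2` diverge at almost full speed. -/
theorem two_mul_sub_six_le_dist (hX : IsCATNegOne X) {p : X} (γ w : GeodesicFrom p)
    (hang : Real.pi / 2 ≤ alexandrovAngle γ w) {c c' : ℝ → X} (hc : IsGeodesicOn c univ)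
    (hc' : IsGeodesicOn c' univ) (h : EqOn c γ.toFun (Icc 0 γ.length))
    (h' : EqOn c' w.toFun (Icc 0 w.length)) {t : ℝ} (ht : 1 ≤ t) :
    2 * t - 6 ≤ dist (c t) (c' t) := by
  have c0 : c 0 = p := by rw [h ⟨le_rfl, γ.length_pos.le⟩, γ.map_zero]
  have c0' : c' 0 = p := by rw [h' ⟨le_rfl, w.length_pos.le⟩, w.map_zero]
  -- Otherwise comparison pulls the closeness back to `p`: the rays are within `s / 2` at small time
  -- `s`, which forces an angle of at most `π / 3`.
  have far : Real.sinh t < 5 * Real.sinh (dist (c t) (c' t) / 2) := by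
    by_contra! hle
    suffices alexandrovAngle γ w ≤ Real.pi / 3 by linarith [Real.pi_pos]
    have small : ∀ s, 0 ≤ s → s ≤ 1 / 4 → dist (c s) (c' s) ≤ s / 2 := by
      intro s h0 h1
      have hd : ∀ f : ℝ → X, IsGeodesicOn f univ → f 0 = p →
          dist p (f t) = t ∧ dist p (f s) = s ∧ dist (f s) (f t) = t - s := by
        rintro f hf rfl
        refine ⟨?_, ?_, ?_⟩
        · rw [hf _ trivial _ trivial, zero_sub, abs_neg, abs_of_nonneg (by linarith)]
        · rw [hf _ trivial _ trivial, zero_sub, abs_neg, abs_of_nonneg h0]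
        · rw [hf _ trivial _ trivial, abs_sub_comm, abs_of_nonneg (by linarith)]
      obtain ⟨a1, a2, a3⟩ := hd c hc c0
      obtain ⟨b1, b2, b3⟩ := hd c' hc' c0'
      have key := hX.sinh_half_dist_mul_le h0 (by linarith) a1 b1 a2 a3 b2 b3
      have pt : 0 < Real.sinh t := Real.sinh_pos_iff.2 (by linarith)
      have ns : 0 ≤ Real.sinh s := Real.sinh_nonneg_iff.2 h0
      have e1 : 5 * Real.sinh (dist (c s) (c' s) / 2) ≤ Real.sinh s := by
        apply le_of_mul_le_mul_right _ pt
        nlinarith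
      have e2 : dist (c s) (c' s) / 2 ≤ Real.sinh (dist (c s) (c' s) / 2) :=
        Real.self_le_sinh_iff.2 (by positivity)
      linarith [Real.sinh_le_five_fourths h0 h1]
    apply limsup_le_of_le (alexandrovAngle_bddBelow γ w).isCoboundedUnder_le
    filter_upwards [eventually_small γ.length_pos, eventually_small w.length_pos,
      eventually_small (show (0 : ℝ) < 1 / 4 by norm_num)] with s hs1 hs2 hs3
    obtain ⟨⟨x0, x1⟩, -⟩ := hs1
    obtain ⟨-, y0, y1⟩ := hs2
    obtain ⟨⟨-, x2⟩, -, y2⟩ := hs3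
    have dle : 2 * dist (γ.toFun s.1) (w.toFun s.2) ≤ 2 * max s.1 s.2 - min s.1 s.2 := by
      rw [← h ⟨x0.le, x1⟩, ← h' ⟨y0.le, y1⟩]
      rcases le_total s.1 s.2 with hs | hs
      · rw [max_eq_right hs, min_eq_left hs]
        have := dist_triangle (c s.1) (c' s.1) (c' s.2)
        rw [hc' _ trivial _ trivial, abs_sub_comm, abs_of_nonneg (by linarith)] at this
        linarith [small s.1 x0.le x2]
      · rw [max_eq_left hs, min_eq_right hs]
        have := dist_triangle (c s.1) (c s.2) (c' s.2)
        rw [hc _ trivial _ trivial, abs_of_nonneg (by linarith)] at this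
        linarith [small s.2 y0.le y2]
    rw [← Real.arccos_cos (x := Real.pi / 3) (by linarith [Real.pi_pos])
        (by linarith [Real.pi_pos]),
      Real.cos_pi_div_three]
    apply Real.arccos_le_arccos
    rw [γ.dist_eq x0.le x1, w.dist_eq y0.le y1, le_div_iff₀ (by positivity)]
    have dn := dist_nonneg (x := γ.toFun s.1) (y := w.toFun s.2)
    rcases le_total s.1 s.2 with hs | hs
    · rw [max_eq_right hs, min_eq_left hs] at dle
      nlinarith
    · rw [max_eq_left hs, min_eq_right hs] at dle
      nlinarith
  -- The estimates below give `exp t ≤ 10 * exp (dist (c t) (c' t) / 2)`, and absorbing `10` into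
  -- `exp 3` produces the `6`.
  have e3 : (10 : ℝ) ≤ Real.exp 3 := by
    have h1 := Real.exp_one_gt_d9
    have h2 : Real.exp 3 = Real.exp 1 ^ 3 := by rw [← Real.exp_nat_mul]; norm_num
    rw [h2]
    calc (10 : ℝ) ≤ 2.5 ^ 3 := by norm_num
      _ ≤ _ := by gcongr; linarith
  have e4 : Real.exp t ≤ 4 * Real.sinh t := by
    rw [Real.sinh_eq]
    have h1 : 2 ≤ Real.exp t := by linarith [Real.add_one_le_exp t]
    have h2 : Real.exp (-t) * Real.exp t = 1 := by rw [← Real.exp_add]; simp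
    nlinarith [Real.exp_pos (-t)]
  have e5 : 2 * Real.sinh (dist (c t) (c' t) / 2) ≤ Real.exp (dist (c t) (c' t) / 2) := by
    rw [Real.sinh_eq]
    linarith [Real.exp_pos (-(dist (c t) (c' t) / 2))]
  have e6 : Real.exp t ≤ Real.exp (dist (c t) (c' t) / 2 + 3) := by
    rw [Real.exp_add]
    nlinarith [Real.exp_pos (dist (c t) (c' t) / 2)]
  have := Real.exp_le_exp.1 e6
  linarith

/-- Exponential convergence of two geodesics issuing from `p`. -/
theorem sinh_half_dist_mul_le' (hX : IsCATNegOne X) {p q r x y : X} {R s : ℝ} (hsR : s ≤ R)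
    (hq : R ≤ dist p q) (hr : R ≤ dist p r) (hx : dist p x = s) (hxq : dist x q = dist p q - s)
    (hy : dist p y = s) (hyr : dist y r = dist p r - s) :
    Real.sinh (dist x y / 2) * Real.sinh R ≤
      Real.sinh s * Real.sinh ((dist p q - R + dist q r + (dist p r - R)) / 2) := by
  have hs : 0 ≤ s := hx ▸ dist_nonneg
  -- Cut both sides at radius `R` to reduce to the isosceles case.
  obtain ⟨q', h1, h2⟩ := hX.exists_between x q (s := R - s) (by linarith) (by linarith)
  obtain ⟨r', h3, h4⟩ := hX.exists_between y r (s := R - s) (by linarith) (by linarith)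
  have hq' : dist p q' = R :=
    le_antisymm (by linarith [dist_triangle p x q']) (by linarith [dist_triangle p q' q])
  have hr' : dist p r' = R :=
    le_antisymm (by linarith [dist_triangle p y r']) (by linarith [dist_triangle p r' r])
  apply (hX.sinh_half_dist_mul_le hs hsR hq' hr' hx h1 hy h3).trans
  apply mul_le_mul_of_nonneg_left _ (Real.sinh_nonneg_iff.2 hs)
  apply Real.sinh_le_sinh.2
  linarith [dist_triangle4 q' q r r', dist_comm r' r]

/-- Lines at finite distance have the same image. -/
theorem exists_eq_of_asymptotic (hX : IsCATNegOne X) {c c' : ℝ → X} (hc : IsGeodesicOn c univ)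
    (hc' : IsGeodesicOn c' univ) {L : ℝ} (hL : ∀ t, dist (c t) (c' t) ≤ L) :
    ∃ u, c' u = c 0 := by
  have hL0 : 0 ≤ L := dist_nonneg.trans (hL 0)
  have approx : ∀ n : ℝ, 0 < n → ∃ u ∈ Icc (-L) L,
      dist (c 0) (c' u) ≤ 2 * Real.sinh (2 * L) / n := by
    intro n hn
    -- Compare both lines with the diagonal from `c (-T)` to `c' T`, once from each end. The choice
    -- of `T` makes `2 * T - L = (T + L) + n`, so each comparison gains a factor `1 / n`.
    obtain ⟨T, hT⟩ : ∃ T, T = n + 2 * L := ⟨_, rfl⟩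
    set N := dist (c (-T)) (c' T) with hN
    have dcc : dist (c (-T)) (c T) = 2 * T := by
      rw [hc _ trivial _ trivial, abs_sub_comm, abs_of_nonneg (by linarith)]; ring
    have dcc' : dist (c' T) (c' (-T)) = 2 * T := by
      rw [hc' _ trivial _ trivial, abs_of_nonneg (by linarith)]; ring
    have dc0 : dist (c (-T)) (c 0) = T := by
      rw [hc _ trivial _ trivial, abs_sub_comm, abs_of_nonneg (by linarith)]; ring
    have dc1 : dist (c 0) (c T) = 2 * T - T := by
      rw [hc _ trivial _ trivial, abs_sub_comm, abs_of_nonneg (by linarith)]; ring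
    have N1 : N ≤ 2 * T + L := by linarith [dist_triangle (c (-T)) (c T) (c' T), hL T]
    have N2 : 2 * T - L ≤ N := by
      linarith [dist_triangle (c (-T)) (c' T) (c T), hL T, dist_comm (c T) (c' T)]
    obtain ⟨z, hz, hz'⟩ := hX.exists_between (c (-T)) (c' T) (s := T) (by linarith) (by linarith)
    rw [← hN] at hz'
    have bound : ∀ d s E : ℝ, s ≤ T + L → 0 ≤ d → E ≤ 2 * L →
        Real.sinh (d / 2) * Real.sinh (2 * T - L) ≤ Real.sinh s * Real.sinh E → 0 ≤ s →
        d ≤ Real.sinh (2 * L) / n := by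
      intro d s E hs hd hE hle hs0
      have p1 : 0 < Real.sinh (T + L) := Real.sinh_pos_iff.2 (by linarith)
      have p2 : n ≤ Real.sinh n := Real.self_le_sinh_iff.2 hn.le
      have p3 : d / 2 ≤ Real.sinh (d / 2) := Real.self_le_sinh_iff.2 (by linarith)
      have p4 : 0 ≤ Real.sinh (2 * L) := Real.sinh_nonneg_iff.2 (by linarith)
      have p5 : 2 * (Real.sinh (T + L) * Real.sinh n) ≤ Real.sinh (2 * T - L) := by
        rw [show 2 * T - L = (T + L) + n by rw [hT]; ring, Real.sinh_add (T + L) n]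
        nlinarith [(Real.sinh_lt_cosh n).le, (Real.sinh_lt_cosh (T + L)).le]
      have p6 : Real.sinh s * Real.sinh E ≤ Real.sinh (T + L) * Real.sinh (2 * L) :=
        mul_le_mul_of_nonneg (Real.sinh_le_sinh.2 hs) (Real.sinh_le_sinh.2 hE)
          (Real.sinh_nonneg_iff.2 hs0) p4
      rw [le_div_iff₀ hn]
      apply le_of_mul_le_mul_left _ p1
      have p7 : d / 2 * n ≤ Real.sinh (d / 2) * Real.sinh n :=
        mul_le_mul p3 p2 hn.le (by linarith)
      have p8 := mul_le_mul_of_nonneg_left p5 (show 0 ≤ Real.sinh (d / 2) by linarith)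
      have p9 := mul_le_mul_of_nonneg_left p7 p1.le
      linarith
    have s1 := hX.sinh_half_dist_mul_le' (p := c (-T)) (q := c T) (r := c' T) (x := c 0) (y := z)
      (R := 2 * T - L) (s := T) (by linarith) (by linarith) (by linarith) dc0
      (by rw [dc1, dcc]) hz hz'
    have b1 := bound _ _ _ (by linarith) dist_nonneg (by linarith [hL T]) s1 (by linarith)
    have s2 := hX.sinh_half_dist_mul_le' (p := c' T) (q := c (-T)) (r := c' (-T)) (x := z)
      (y := c' (T - (N - T)))
      (R := 2 * T - L) (s := N - T) (by linarith) (by rw [dist_comm]; linarith) (by linarith)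
      (by rw [dist_comm, hz']) (by rw [dist_comm z, dist_comm (c' T), hz, ← hN]; ring)
      (by rw [hc' _ trivial _ trivial, sub_sub_cancel, abs_of_nonneg (by linarith)])
      (by rw [dcc', hc' _ trivial _ trivial, abs_of_nonneg (by linarith)]; ring)
    have b2 := bound _ _ _ (by linarith) dist_nonneg
      (by rw [dist_comm (c' T), ← hN]; linarith [hL (-T)]) s2 (by linarith)
    refine ⟨T - (N - T), ⟨by linarith, by linarith⟩, ?_⟩
    rw [show 2 * Real.sinh (2 * L) / n = Real.sinh (2 * L) / n + Real.sinh (2 * L) / n by ring]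
    linarith [dist_triangle (c 0) z (c' (T - (N - T)))]
  -- The approximating parameters stay in a fixed compact interval, so the infimum distance `0` is
  -- attained.
  obtain ⟨u, hu, hmin⟩ := isCompact_Icc.exists_isMinOn (s := Icc (-L) L) ⟨0, by simpa using hL0⟩
    (f := fun u => dist (c 0) (c' u))
    (continuous_const.dist hc'.isometry.continuous).continuousOn
  refine ⟨u, (dist_le_zero.1 ?_).symm⟩
  have hlim : Tendsto (fun n : ℝ => 2 * Real.sinh (2 * L) / n) atTop (𝓝 0) :=
    tendsto_const_nhds.div_atTop tendsto_id
  apply ge_of_tendsto hlim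
  filter_upwards [eventually_gt_atTop 0] with n hn
  obtain ⟨v, hv, hle⟩ := approx n hn
  exact (isMinOn_iff.1 hmin v hv).trans hle

/-- An isometry at finite distance from the identity is the identity. -/
theorem isometry_eq_id (hX : IsCATNegOne X) (hext : HasGeodesicExtension X)
    (hdir : HasConnectedDirections X) {e : X → X} (he : Isometry e) {L : ℝ}
    (hL : ∀ x, dist (e x) x ≤ L) (p : X) : e p = p := by
  by_contra hne
  obtain ⟨γ, hγ, hγe⟩ := hX.exists_geodesicFrom (p := p) (q := e p) (Ne.symm hne)
  obtain ⟨w, hw⟩ := exists_perpendicular hext hdir γ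
  obtain ⟨c, hc, c0, h⟩ := exists_line hext w
  obtain ⟨u, hu⟩ := hX.exists_eq_of_asymptotic (c := e ∘ c) (c' := c)
    (fun t _ t' _ => by rw [Function.comp, Function.comp, he.dist_eq, hc _ trivial _ trivial]) hc
    (fun t => hL (c t))
  simp only [Function.comp, c0] at hu
  have hℓ : 0 < γ.length := γ.length_pos
  have hd : dist p (e p) = |u| := by
    rw [← hu, ← c0, hc _ trivial _ trivial, zero_sub, abs_neg]
  have γbetween : ∀ s, 0 ≤ s → s ≤ γ.length →
      dist p (γ.toFun s) = s ∧ dist (γ.toFun s) (e p) = dist p (e p) - s := by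
    intro s h0 h1
    refine ⟨γ.dist_eq h0 h1, ?_⟩
    have := γ.isGeodesicOn s ⟨h0, h1⟩ γ.length ⟨hℓ.le, le_rfl⟩
    rw [hγ, hγe] at this
    rw [this, abs_sub_comm, abs_of_nonneg (by linarith)]
  have pp := Real.pi_pos
  rcases le_total 0 u with hu0 | hu0
  · rw [abs_of_nonneg hu0] at hd
    have := alexandrovAngle_eq_zero γ w (a := min γ.length w.length) (lt_min hℓ w.length_pos) (by
      intro s h0 h1
      obtain ⟨h2, h3⟩ := le_min_iff.1 h1
      obtain ⟨g1, g2⟩ := γbetween s h0.le h2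
      refine hX.eq_of_between g1 g2 ?_ ?_
      · exact w.dist_eq h0.le h3
      · rw [← h ⟨h0.le, h3⟩, hd, ← hu, hc _ trivial _ trivial, abs_sub_comm,
          abs_of_nonneg (by linarith)])
    linarith
  · rw [abs_of_nonpos hu0] at hd
    have := alexandrovAngle_eq_pi γ w (a := min γ.length w.length) (lt_min hℓ w.length_pos) (by
      intro s t h0 h1 h2 h3
      obtain ⟨h4, -⟩ := le_min_iff.1 h1
      obtain ⟨-, h5⟩ := le_min_iff.1 h3
      obtain ⟨g1, g2⟩ := γbetween s h0.le h4
      have : γ.toFun s = c (-s) := by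
        refine hX.eq_of_between g1 g2 ?_ ?_
        · rw [← c0, hc _ trivial _ trivial, sub_neg_eq_add, zero_add, abs_of_pos h0]
        · rw [hd, ← hu, hc _ trivial _ trivial, abs_of_nonneg (by linarith)]
          ring
      rw [this, ← h ⟨h2.le, h5⟩, hc _ trivial _ trivial, abs_sub_comm, sub_neg_eq_add,
        abs_of_pos (by linarith), add_comm])
    linarith

/-- A coarse isometry at finite distance from the identity is at uniformly bounded distance from
the identity. -/
theorem dist_le_of_coarse_isometry (hX : IsCATNegOne X) (hext : HasGeodesicExtension X)
    (hdir : HasConnectedDirections X) {h : X → X} {C L : ℝ}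
    (hlow : ∀ x y, dist x y - C ≤ dist (h x) (h y)) (hupp : ∀ x y, dist (h x) (h y) ≤ dist x y + C)
    (hL : ∀ x, dist (h x) x ≤ L) (p : X) : dist (h p) p ≤ 3 * C + 21 := by
  have hC : 0 ≤ C := by simpa using hupp p p
  rcases eq_or_ne (h p) p with heq | hne
  · rw [heq, dist_self]; linarith
  have hL0 : 0 ≤ L := dist_nonneg.trans (hL p)
  obtain ⟨γ₁, -, -⟩ := hX.exists_geodesicFrom (Ne.symm hne)
  obtain ⟨γ₂, h12⟩ := exists_opposite hext γ₁
  obtain ⟨γ₃, h13⟩ := exists_perpendicular hext hdir γ₁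
  have h23 := alexandrovAngle_triangle γ₁ γ₃ γ₂
  rw [h12, h13, alexandrovAngle_comm] at h23
  have pp := Real.pi_pos
  obtain ⟨c₁, hc₁, z₁, E₁⟩ := exists_line hext γ₁
  obtain ⟨c₂, hc₂, z₂, E₂⟩ := exists_line hext γ₂
  obtain ⟨c₃, hc₃, z₃, E₃⟩ := exists_line hext γ₃
  -- So large that, seen from `h p`, each endpoint `v` and its image `h v` have a Gromov product
  -- exceeding every bound used below.
  set t := 1 + L + 2 * C + dist (h p) p + 20 with ht
  have t1 : 1 ≤ t := by rw [ht]; linarith [dist_nonneg (x := h p) (y := p)]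
  have hd : ∀ f : ℝ → X, IsGeodesicOn f univ → f 0 = p → dist p (f t) = t := by
    rintro f hf rfl
    rw [hf _ trivial _ trivial, zero_sub, abs_neg, abs_of_nonneg (by linarith)]
  have D12 := hX.two_mul_sub_six_le_dist γ₁ γ₂ (by linarith) hc₁ hc₂ E₁ E₂ t1
  have D13 := hX.two_mul_sub_six_le_dist γ₁ γ₃ (by linarith) hc₁ hc₃ E₁ E₃ t1
  have D23 := hX.two_mul_sub_six_le_dist γ₂ γ₃ (by linarith) hc₂ hc₃ E₂ E₃ t1
  replace hd : dist p (c₁ t) = t ∧ dist p (c₂ t) = t ∧ dist p (c₃ t) = t :=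
    ⟨hd c₁ hc₁ z₁, hd c₂ hc₂ z₂, hd c₃ hc₃ z₃⟩
  generalize c₁ t = a at *
  generalize c₂ t = b at *
  generalize c₃ t = c at *
  obtain ⟨d1, d2, d3⟩ := hd
  -- `h p` lies coarsely on `[h x, h y]`. Two uses of the four-point inequality replace `h x`, `h y`
  -- by `x`, `y`, each costing `2`.
  have prod : ∀ x y : X, dist p x = t → dist p y = t → 2 * t - 6 ≤ dist x y →
      dist (h p) x + dist (h p) y - dist x y ≤ 3 * C + 10 := by
    intro x y hx hy hxy
    have f1 := hX.four_point (h p) (h x) x (h y)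
    have f2 := hX.four_point (h p) x y (h y)
    have g1 : dist (h p) (h x) + dist (h p) (h y) - dist (h x) (h y) ≤ 3 * C + 6 := by
      linarith [hlow x y, hupp p x, hupp p y]
    have big : ∀ v, dist p v = t → 3 * C + 10 < dist (h p) (h v) + dist (h p) v - dist (h v) v := by
      intro v hv
      linarith [hlow p v, hL v, dist_triangle p (h p) v, dist_comm p (h p),
        dist_nonneg (x := h p) (y := p)]
    have b1 := big x hx
    have b2 := big y hy
    rw [dist_comm (h y) y, add_comm (dist (h p) (h y))] at b2
    rcases min_le_iff.1 (show min _ _ ≤ _ by linarith [f1] :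
      min (dist (h p) (h x) + dist (h p) x - dist (h x) x)
      (dist (h p) x + dist (h p) (h y) - dist x (h y)) ≤ 3 * C + 8) with q | q
    · linarith
    rcases min_le_iff.1 (show min _ _ ≤ _ by linarith [f2] :
      min (dist (h p) x + dist (h p) y - dist x y)
      (dist (h p) y + dist (h p) (h y) - dist y (h y)) ≤ 3 * C + 10) with q' | q'
    · exact q'
    · linarith
  have P12 := prod a b d1 d2 D12
  have P13 := prod a c d1 d3 D13
  have P23 := prod b c d2 d3 D23
  have tri : ∀ x y : X, dist p x = t → dist p y = t → dist x y ≤ 2 * t := by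
    intro x y hx hy
    linarith [dist_triangle_left x y p]
  have T12 := tri a b d1 d2
  have T13 := tri a c d1 d3
  have T23 := tri b c d2 d3
  have U23 := dist_triangle_left b c (h p)
  have U13 := dist_triangle_left a c (h p)
  -- The segment from `p` to `h p` diverges from the one towards `a` or `b`, so `dist (h p) p` is at
  -- most `8` plus the excess over `t` of the distance from `h p` to that endpoint. By `P12`, `P13`,
  -- `P23` this excess is at most `3 * C + 13`.
  have f := hX.four_point p a (h p) b
  rw [dist_comm p (h p)] at f
  rcases min_le_iff.1 (show min _ _ ≤ _ by linarith [f] :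
      min (dist p a + dist (h p) p - dist a (h p))
    (dist (h p) p + dist p b - dist (h p) b) ≤ 8) with q | q
  · rw [dist_comm a] at q
    linarith
  · linarith

end IsCATNegOne

/-! ### Group actions on CAT(-1) spaces -/

namespace IsCATNegOne

variable {G X : Type*} [Group G] [MetricSpace X] [MulAction G X]

/-- An isometry of a proper CAT(-1) space with a bounded orbit fixes the circumcentre of the
orbit. -/
theorem exists_fixed_of_bounded_orbit [ProperSpace X] (hX : IsCATNegOne X)
    (hG : ∀ g : G, Isometry (fun x : X => g • x)) (g : G) (x : X) {R : ℝ}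
    (hR : ∀ n : ℤ, dist (g ^ n • x) x ≤ R) : ∃ z : X, g • z = z := by
  have bdd : ∀ z, BddAbove (range fun n : ℤ => dist z (g ^ n • x)) := by
    rintro z
    refine ⟨dist z x + R, ?_⟩
    rintro _ ⟨n, rfl⟩
    linarith [dist_triangle_right z (g ^ n • x) x, hR n]
  set r : X → ℝ := fun z => ⨆ n : ℤ, dist z (g ^ n • x) with hr
  have le_r : ∀ z (n : ℤ), dist z (g ^ n • x) ≤ r z := fun z n => le_ciSup (bdd z) n
  have r_nonneg : ∀ z, 0 ≤ r z := fun z => dist_nonneg.trans (le_r z 0)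
  have lip : LipschitzWith 1 r := LipschitzWith.of_le_add fun y z => ciSup_le fun n => by
    linarith [dist_triangle y z (g ^ n • x), le_r z n]
  have := hX.nonempty
  obtain ⟨z, hz⟩ := lip.continuous.exists_forall_le (by
    apply tendsto_atTop_mono (f := fun z => dist z x) _ (tendsto_dist_right_cocompact_atTop x)
    intro z
    simpa using le_r z 0)
  -- `g` only shifts the indices of the orbit.
  have hinv : r (g • z) = r z := by
    rw [hr]
    refine (Equiv.subRight (1 : ℤ)).iSup_congr fun n => ?_
    have := (hG g).dist_eq z (g ^ (n - 1) • x)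
    rw [smul_smul, ← zpow_one_add, add_sub_cancel] at this
    exact this.symm
  refine ⟨z, dist_le_zero.1 ?_⟩
  set s := dist (g • z) z / 2 with hs
  have s0 : 0 ≤ s := by positivity
  obtain ⟨m, hm, hm'⟩ := hX.exists_between (g • z) z (s := s) s0 (by linarith)
  have hc : 1 ≤ Real.cosh s := Real.one_le_cosh s
  -- The midpoint of `g • z` and `z` would have a smaller circumradius than the minimizer `z`,
  -- unless `s = 0`.
  have key : ∀ n : ℤ, Real.cosh s * Real.cosh (dist m (g ^ n • x)) ≤ Real.cosh (r z) := by
    intro n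
    have h1 := hX.cosh_dist_midpoint_le (p := g ^ n • x) hm (by linarith : dist m z = s)
      (by linarith)
    have h2 := Real.cosh_le_cosh_of_le dist_nonneg (le_r z n)
    have h3 := Real.cosh_le_cosh_of_le dist_nonneg (le_r (g • z) n)
    rw [hinv] at h3
    linarith
  have hq : 1 ≤ Real.cosh (r z) / Real.cosh s := by
    rw [le_div_iff₀ (by linarith), one_mul]
    have := key 0
    nlinarith [Real.one_le_cosh (dist m (g ^ (0 : ℤ) • x))]
  have hle : r m ≤ Real.arcosh (Real.cosh (r z) / Real.cosh s) := by
    apply ciSup_le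
    intro n
    rw [← abs_of_nonneg (dist_nonneg (x := m) (y := g ^ n • x)),
      ← abs_of_nonneg (Real.arcosh_nonneg hq), ← Real.cosh_le_cosh, Real.cosh_arcosh hq,
      le_div_iff₀ (by linarith), mul_comm]
    exact key n
  have h1 := Real.cosh_le_cosh_of_le (r_nonneg z) ((hz m).trans hle)
  rw [Real.cosh_arcosh hq, le_div_iff₀ (by linarith)] at h1
  have h2 : Real.cosh s ≤ 1 := by
    nlinarith [Real.cosh_pos (r z)]
  by_contra! hpos
  have := Real.one_lt_cosh.2 (show s ≠ 0 by rw [hs]; positivity)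
  linarith

/-- If `m` is the midpoint of `[x, g x]`, then `g m` is that of `[g x, g² x]`, and midpoints are at
most half as far apart as `x` and `g² x`. -/
theorem two_mul_translationLength_le (hX : IsCATNegOne X)
    (hG : ∀ g : G, Isometry (fun x : X => g • x)) (g : G) (x : X) :
    2 * translationLength X g ≤ dist (g ^ 2 • x) x := by
  have bdd : BddBelow (range fun x : X => dist (g • x) x) := ⟨0, by
    rintro _ ⟨y, rfl⟩; exact dist_nonneg⟩
  set s := dist (g • x) x / 2 with hs
  obtain ⟨m, hm, hm'⟩ := hX.exists_between x (g • x) (s := s) (by positivity)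
    (by rw [dist_comm]; linarith [dist_nonneg (x := g • x) (y := x)])
  have hD : dist x (g • x) = 2 * s := by rw [dist_comm]; linarith
  have e1 : dist (g • x) (g • m) = s := by rw [(hG g).dist_eq, hm]
  have e2 : dist (g • m) (g ^ 2 • x) = s := by
    rw [pow_two, mul_smul, (hG g).dist_eq, hm', hD]; ring
  have e3 : dist (g • x) (g ^ 2 • x) = 2 * s := by
    rw [pow_two, mul_smul, (hG g).dist_eq, hD]
  have h := hX.dist_midpoints_le e3 (by rw [dist_comm, hD]) e1 e2
    (y := m) (by rw [dist_comm, hm', hD]; ring) (by rw [dist_comm, hm])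
  have : translationLength X g ≤ dist (g • m) m := ciInf_le bdd m
  linarith

theorem two_pow_mul_translationLength_le (hX : IsCATNegOne X)
    (hG : ∀ g : G, Isometry (fun x : X => g • x)) (g : G) (k : ℕ) (x : X) :
    2 ^ k * translationLength X g ≤ dist (g ^ 2 ^ k • x) x := by
  have := hX.nonempty
  suffices 2 ^ k * translationLength X g ≤ translationLength X (g ^ 2 ^ k) from
    this.trans (ciInf_le ⟨0, by rintro _ ⟨y, rfl⟩; exact dist_nonneg⟩ x)
  induction k with
  | zero => simp
  | succ k ih =>
    apply le_ciInf
    intro y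
    have := hX.two_mul_translationLength_le hG (g ^ 2 ^ k) y
    rw [← pow_mul, ← pow_succ] at this
    rw [pow_succ]
    linarith

end IsCATNegOne

/-! ### Comparison of translation lengths and transport of the action -/

theorem dist_pow_smul_le {G X : Type*} [Group G] [MetricSpace X] [MulAction G X]
    (hG : ∀ g : G, Isometry (fun x : X => g • x)) (g : G) (x : X) (n : ℕ) :
    dist (g ^ n • x) x ≤ n * dist (g • x) x := by
  induction n with
  | zero => simp
  | succ n ih =>
    have h1 := dist_triangle (g ^ n • g • x) (g ^ n • x) x
    rw [(hG (g ^ n)).dist_eq] at h1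
    rw [pow_succ, mul_smul]
    push_cast
    linarith

/-- Displacements that are coarsely smaller give smaller translation lengths. -/
theorem translationLength_le_of_displacement_le {G X Y : Type*} [Group G] [MetricSpace X]
    [MulAction G X] [MetricSpace Y] [MulAction G Y] (hX : IsCATNegOne X) [Nonempty Y]
    (hGX : ∀ g : G, Isometry (fun x : X => g • x)) (hGY : ∀ g : G, Isometry (fun y : Y => g • y))
    {x : X} {y : Y} {K : ℝ} (h : ∀ g : G, dist (g • x) x ≤ dist (g • y) y + K) (g : G) :
    translationLength X g ≤ translationLength Y g := by
  apply le_ciInf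
  intro z
  -- For `g ^ 2 ^ k` the main terms scale by `2 ^ k` while the additive error stays fixed.
  have bound : ∀ k : ℕ, translationLength X g - dist (g • z) z ≤ (K + 2 * dist y z) / 2 ^ k := by
    intro k
    have h1 := hX.two_pow_mul_translationLength_le hGX g k x
    have h2 := h (g ^ 2 ^ k)
    have h3 := dist_pow_smul_le hGY g z (2 ^ k)
    have h4 := dist_triangle4 (g ^ 2 ^ k • y) (g ^ 2 ^ k • z) z y
    rw [(hGY (g ^ 2 ^ k)).dist_eq, dist_comm z y] at h4
    push_cast at h3
    rw [le_div_iff₀ (by positivity)]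
    linarith
  have hlim : Tendsto (fun k : ℕ => (K + 2 * dist y z) / (2 : ℝ) ^ k) atTop (𝓝 0) :=
    tendsto_const_nhds.div_atTop (tendsto_pow_atTop_atTop_of_one_lt one_lt_two)
  linarith [ge_of_tendsto' hlim bound]

/-- A geometric action on a proper CAT(-1) space is transported to a geometric action by a coarse
conjugacy `φ`. -/
theorem IsGeometricAction.of_coarse_conjugacy {G X Y : Type*} [Group G] [MetricSpace X]
    [ProperSpace X] [MulAction G X] [MetricSpace Y] [ProperSpace Y] [MulAction G Y]
    (hX : IsCATNegOne X) (hG : IsGeometricAction G X)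
    (hGY : ∀ g : G, Isometry (fun y : Y => g • y)) {C E : ℝ} {φ : X → Y}
    (hφ : IsAlmostIsometryWith C φ) (hE : ∀ (g : G) (x : X), dist (g • φ x) (φ (g • x)) ≤ E) :
    IsGeometricAction G Y := by
  obtain ⟨x₀⟩ := hX.nonempty
  have displ : ∀ g : G, dist (g • x₀) x₀ ≤ dist (g • φ x₀) (φ x₀) + (C + E) := by
    intro g
    linarith [hφ.lower (g • x₀) x₀, dist_triangle_left (φ (g • x₀)) (φ x₀) (g • φ x₀), hE g x₀]
  refine ⟨hGY, fun K hK => ?_, fun g y hgy => ?_, ?_⟩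
  · obtain ⟨R, hR⟩ := hK.isBounded.subset_closedBall (φ x₀)
    apply (hG.proper _ (isCompact_closedBall x₀ (2 * R + (C + E)))).subset
    rintro g ⟨_, ⟨k, hk, rfl⟩, hk'⟩
    have h1 := hR hk
    have h2 := hR hk'
    rw [Metric.mem_closedBall] at h1 h2
    have h3 := dist_triangle (g • φ x₀) (g • k) (φ x₀)
    rw [(hGY g).dist_eq, dist_comm (φ x₀)] at h3
    have h4 := displ g
    have h5 : 0 ≤ 2 * R + (C + E) := by linarith [dist_nonneg (x := g • x₀) (y := x₀)]
    exact ⟨g • x₀, ⟨x₀, Metric.mem_closedBall_self h5, rfl⟩, by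
      rw [Metric.mem_closedBall]; linarith⟩
  -- A fixed point of `g` in `Y` bounds the displacements of `φ x₀`, hence of `x₀`, under all powers
  -- of `g`.
  · obtain ⟨z, hz⟩ := hX.exists_fixed_of_bounded_orbit hG.isometric g x₀
      (R := 2 * dist (φ x₀) y + (C + E)) (by
        intro n
        have h1 : g ^ n • y = y := by
          have : g ∈ MulAction.stabilizer G y := hgy
          exact zpow_mem this n
        have h2 := dist_triangle (g ^ n • φ x₀) (g ^ n • y) (φ x₀)
        rw [(hGY (g ^ n)).dist_eq, h1, dist_comm y] at h2
        linarith [displ (g ^ n)])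
    exact hG.free g z hz
  · obtain ⟨K, hK, hcov⟩ := hG.cocompact
    obtain ⟨R, hR⟩ := hK.isBounded.subset_closedBall x₀
    refine ⟨Metric.closedBall (φ x₀) (R + C + (E + C)), isCompact_closedBall _ _, fun y => ?_⟩
    obtain ⟨x, hx⟩ := hφ.coarselyOnto y
    obtain ⟨g, k, hk, rfl⟩ := hcov x
    refine ⟨g, g⁻¹ • y, ?_, smul_inv_smul g y⟩
    have h1 := hR hk
    rw [Metric.mem_closedBall] at h1 ⊢
    have h2 := (hGY g).dist_eq (g⁻¹ • y) (φ k)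
    simp only [smul_inv_smul] at h2
    linarith [dist_triangle (g⁻¹ • y) (φ k) (φ x₀), hφ.upper k x₀, hE g k,
      dist_triangle y (φ (g • k)) (g • φ k), dist_comm y (φ (g • k)),
      dist_comm (φ (g • k)) (g • φ k)]

/-- Transport of an isometric action along an almost-isometry onto an almost-isometrically rigid
space. -/
theorem exists_coarsely_conjugate_action {G X Y : Type*} [Group G] [MetricSpace X] [MulAction G X]
    [MetricSpace Y] (hGX : ∀ g : G, Isometry (fun x : X => g • x)) (hY : IsCATNegOne Y)
    (hYext : HasGeodesicExtension Y) (hYdir : HasConnectedDirections Y) (hAI : IsAIRigid Y)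
    {C : ℝ} {φ : X → Y} (hφ : IsAlmostIsometryWith C φ) :
    ∃ (_ : MulAction G Y) (E : ℝ), (∀ g : G, Isometry (fun y : Y => g • y)) ∧
      ∀ (g : G) (x : X), dist (g • φ x) (φ (g • x)) ≤ E := by
  choose ψ hψ using hφ.coarselyOnto
  have ψφ : ∀ x, dist (ψ (φ x)) x ≤ 2 * C := fun x => by
    linarith [hφ.lower (ψ (φ x)) x, hψ (φ x)]
  have φg : ∀ (g : G) (x z : X), dist (φ (g • x)) (φ (g • z)) ≤ dist x z + C := fun g x z => by
    simpa [(hGX g).dist_eq] using hφ.upper (g • x) (g • z)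
  have hlow : ∀ (g : G) (y z : Y), dist y z - 4 * C ≤ dist (φ (g • ψ y)) (φ (g • ψ z)) := by
    intro g y z
    have h1 := hφ.lower (g • ψ y) (g • ψ z)
    rw [(hGX g).dist_eq] at h1
    linarith [hφ.upper (ψ y) (ψ z), dist_triangle4 y (φ (ψ y)) (φ (ψ z)) z, hψ y, hψ z,
      dist_comm y (φ (ψ y))]
  have hupp : ∀ (g : G) (y z : Y), dist (φ (g • ψ y)) (φ (g • ψ z)) ≤ dist y z + 4 * C := by
    intro g y z
    linarith [φg g (ψ y) (ψ z), hφ.lower (ψ y) (ψ z), dist_triangle4 (φ (ψ y)) y z (φ (ψ z)),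
      hψ y, hψ z, dist_comm z (φ (ψ z))]
  have hAIg : ∀ g : G, IsAlmostIsometryWith (4 * C) (fun y => φ (g • ψ y)) := fun g =>
    { nonneg := by linarith [hφ.nonneg]
      lower := hlow g
      upper := hupp g
      coarselyOnto := fun y => by
        obtain ⟨x, hx⟩ := hφ.coarselyOnto y
        refine ⟨φ (g⁻¹ • x), ?_⟩
        have h1 := φg g (ψ (φ (g⁻¹ • x))) (g⁻¹ • x)
        rw [smul_inv_smul] at h1
        linarith [dist_triangle (φ (g • ψ (φ (g⁻¹ • x)))) (φ x) y, ψφ (g⁻¹ • x)] }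
  choose e L hL using fun g => hAI _ _ (hAIg g)
  obtain ⟨D, hD⟩ : ∃ D, D = 3 * (4 * C) + 21 := ⟨_, rfl⟩
  -- The bound `L g` depends on `g`; composing with the inverse of `e g` gives a coarse isometry
  -- near the identity, so the uniform `D` applies.
  have he : ∀ (g : G) (y : Y), dist (φ (g • ψ y)) (e g y) ≤ D := by
    intro g y
    have := hY.dist_le_of_coarse_isometry hYext hYdir (h := fun y => (e g).symm (φ (g • ψ y)))
      (C := 4 * C) (L := L g)
      (fun y z => by rw [(e g).symm.isometry.dist_eq]; exact hlow g y z)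
      (fun y z => by rw [(e g).symm.isometry.dist_eq]; exact hupp g y z)
      (fun y => by
        rw [← (e g).isometry.dist_eq, (e g).apply_symm_apply]
        exact hL g y) y
    rw [← (e g).isometry.dist_eq, (e g).apply_symm_apply] at this
    rwa [hD]
  have e_mul : ∀ (g h : G) (y : Y), e (g * h) y = e g (e h y) := by
    intro g h y
    apply (e (g * h)).symm.injective
    rw [(e (g * h)).symm_apply_apply]
    refine (hY.isometry_eq_id hYext hYdir (e := fun y => (e (g * h)).symm (e g (e h y)))
      (((e (g * h)).symm.isometry.comp (e g).isometry).comp (e h).isometry)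
      (L := D + (D + 4 * C) + (D + 3 * C)) (fun z => ?_) y).symm
    rw [← (e (g * h)).isometry.dist_eq, (e (g * h)).apply_symm_apply]
    have h1 := he g (e h z)
    have h2 := hupp g (e h z) (φ (h • ψ z))
    have h3 := he h z
    have h4 := φg g (ψ (φ (h • ψ z))) (h • ψ z)
    have h5 := he (g * h) z
    rw [mul_smul] at h5
    have h6 := ψφ (h • ψ z)
    have t1 := dist_triangle_left (e g (e h z)) (φ (g • ψ (φ (h • ψ z)))) (φ (g • ψ (e h z)))
    have t2 := dist_triangle4 (e g (e h z)) (φ (g • ψ (φ (h • ψ z)))) (φ (g • h • ψ z))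
      (e (g * h) z)
    rw [dist_comm (e h z)] at h2
    linarith
  have e_one : ∀ y, e 1 y = y := by
    intro y
    -- `e 1` is an injective idempotent.
    apply (e 1).injective
    rw [← e_mul, mul_one]
  let act : MulAction G Y :=
    { smul := fun g y => e g y
      one_smul := e_one
      mul_smul := e_mul }
  refine ⟨act, D + 3 * C, fun g => (e g).isometry, fun g x => ?_⟩
  change dist (e g (φ x)) (φ (g • x)) ≤ _
  linarith [dist_triangle_left (e g (φ x)) (φ (g • x)) (φ (g • ψ (φ x))), he g (φ x),
    φg g (ψ (φ x)) x, ψφ x]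

/-- Equivariant maps between spaces with isometric actions are coarsely onto if the target action
is cocompact. -/
theorem IsGeometricAction.isCoarselyOnto {G X Y : Type*} [Group G] [MetricSpace X] [MulAction G X]
    [Nonempty X] [MetricSpace Y] [MulAction G Y] (hG : IsGeometricAction G Y) {f : X → Y}
    (hf : ∀ (g : G) (x : X), f (g • x) = g • f x) : IsCoarselyOnto f := by
  obtain ⟨x₀⟩ := ‹Nonempty X›
  obtain ⟨K, hK, hcov⟩ := hG.cocompact
  obtain ⟨R, hR⟩ := hK.isBounded.subset_closedBall (f x₀)
  refine ⟨max R 0, le_max_right _ _, fun y => ?_⟩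
  obtain ⟨g, k, hk, rfl⟩ := hcov y
  refine ⟨g • x₀, ?_⟩
  rw [hf, (hG.isometric g).dist_eq, dist_comm]
  exact (hR hk).trans (le_max_left _ _)

/-! ### The main theorem -/

theorem theorem1p1 (G : Type w) (X : Type u) (Y : Type v) [Group G]
    [MetricSpace X] [ProperSpace X] [MulAction G X]
    [MetricSpace Y] [ProperSpace Y]
    (hX : IsCATNegOne X) (hXℝ : ¬ Nonempty (X ≃ᵢ ℝ)) (hG : IsGeometricAction G X)
    (hY : IsCATNegOne Y) (hYext : HasGeodesicExtension Y) (hYdir : HasConnectedDirections Y)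
    (hAI : IsAIRigid Y) (hMLS : IsMLSRigid.{u, v, w} G X) :
    AlmostIsometric X Y ↔ ∃ f : X → Y, Isometry f ∧ IsCoarselyOnto f := by
  constructor
  · rintro ⟨C, φ, hφ⟩
    obtain ⟨act, E, hGY, hE⟩ :=
      exists_coarsely_conjugate_action hG.isometric hY hYext hYdir hAI hφ
    have hgeo := IsGeometricAction.of_coarse_conjugacy hX hG hGY hφ hE
    have := hX.nonempty
    have := hY.nonempty
    obtain ⟨x₀⟩ := hX.nonempty
    obtain ⟨f, hf, hfG⟩ := hMLS Y hY hgeo fun g => le_antisymm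
      (translationLength_le_of_displacement_le hX hG.isometric hGY (x := x₀) (y := φ x₀)
        (K := C + E) (fun g => by
          linarith [hφ.lower (g • x₀) x₀,
            dist_triangle_left (φ (g • x₀)) (φ x₀) (g • φ x₀), hE g x₀]) g)
      (translationLength_le_of_displacement_le hY hGY hG.isometric (x := φ x₀) (y := x₀)
        (K := C + E) (fun g => by
          linarith [hφ.upper (g • x₀) x₀,
            dist_triangle (g • φ x₀) (φ (g • x₀)) (φ x₀), hE g x₀]) g)
    exact ⟨f, hf, hgeo.isCoarselyOnto hfG⟩
  · rintro ⟨f, hf, C, hC, hon⟩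
    exact ⟨C, f, hC, fun x y => by rw [hf.dist_eq]; linarith,
      fun x y => by rw [hf.dist_eq]; linarith, hon⟩
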